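/- Let $I$ be a finite set of students and $S$ a finite set of schools. A problem $(P,\succ,q)$ consists of a strict linear preference $P_i$ of each student $i$ over $S\cup\{\emptyset\}$ ($\emptyset$ is the outside option; $s$ is acceptable to $i$ if $s\mathrel{P_i}\emptyset$), a strict linear priority order $\succ_s$ of each school $s$ over $I$, and a capacity $q_s\in\mathbb{N}$ of each school $s$. A matching is a map $\mu:I\to S\cup\{\emptyset\}$ with $|\mu^{-1}(s)|\le q_s$ for all $s\in S$; a mechanism $\varphi$ maps each problem to a matching, and $\varphi_i$ denotes its component for student $i$. Student $i$ is a blocking student for $\mu$ under $(P,\succ,q)$ if there is a school $s$ with $s\mathrel{P_i}\mu(i)$ such that either $|\mu^{-1}(s)|<q_s$, or $\mu(j)=s$ and $i\succ_s j$ for some student $j$. Student $i$ is a manipulating student of $\varphi$ at $(P,\succ,q)$ if there is a preference relation $\hat P_i$ over $S\cup\{\emptyset\}$ with $\varphi_i(\hat P_i,P_{-i},\succ,q)\mathrel{P_i}\varphi_i(P,\succ,q)$. Both of the following mechanisms proceed in steps. At each step, every student who is not currently accepted anywhere applies to her most-preferred acceptable school among those that have not yet rejected her (if any). - Gale–Shapley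 mechanism $GS$: each school $s$ considers its tentatively accepted students together with its new applicants, tentatively accepts the $\succ_s$-highest ones up to its capacity $q_s$, and rejects the others; the tentative acceptances become final when no student is rejected. - Boston mechanism $\beta$: each school $s$ immediately and finally accepts the $\succ_s$-highest of its new applicants up to its remaining capacity, and rejects the others; the algorithm stops when every student has been accepted or has applied to all her acceptable schools. For a natural number $k$, the truncation $P_i^k$ of $P_i$ orders the schools as $P_i$ does, and its acceptable schools are the $k$ most-preferred acceptable schools of $P_i$ (all of them, if there are fewer than $k$). The constrained version of a mechanism $\varphi$ is $\varphi^k(P,\succ,q)=\varphi(P^k,\succ,q)$, where $P^k=(P_i^k)_{i\in I}$. **Theorem.** Let $(P,\succ,q)$ be a problem and $k>1$. Then (i) every blocking student for the outcome $\beta^k(P,\succ,q)$ under $(P,\succ,q)$ is a manipulating student of $\beta^k$ at $(P,\succ,q)$; and (ii) every manipulating student of $GS^k$ at $(P,\succ,q)$ is a blocking student for $GS^k(P,\succ,q)$ under $(P,\succ,q)$. -/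

import Mathlib

namespace SchoolChoice

/-- A strict linear order on `α`: `r.rel a b` reads "`a` is ranked above `b`". -/
structure StrictRanking (α : Type*) where
  rel : α → α → Prop
  strictTotal : IsStrictTotalOrder α rel

/-- A school choice problem with students `I` and schools `S`. Preferences are over
`Option S`, where `none` is the outside option. -/
structure Problem (I S : Type*) where
  pref : I → StrictRanking (Option S)
  prio : S → StrictRanking I
  cap : S → ℕ

/-- A matching: every school `s` receives at most `q s` students. -/
structure Matching (I : Type*) {S : Type*} (q : S → ℕ) where
  assign : I → Option S
  capacity : ∀ s, {i | assign i = some s}.ncard ≤ q s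

/-- A mechanism maps each problem to a matching. -/
abbrev Mechanism (I S : Type*) := (p : Problem I S) → Matching I p.cap

/-- School `s` is acceptable under the preference relation `P`. -/
def Acceptable {S : Type*} (P : StrictRanking (Option S)) (s : S) : Prop :=
  P.rel (some s) none

section Stability

variable {I S : Type*}

/-- The pair `(i, s)` blocks the matching `μ`. -/
def Blocks (p : Problem I S) (μ : Matching I p.cap) (i : I) (s : S) : Prop :=
  (p.pref i).rel (some s) (μ.assign i) ∧
    ((∃ j, μ.assign j = some s ∧ (p.prio s).rel i j) ∨
      {j | μ.assign j = some s}.ncard < p.cap s)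

/-- Student `i` is a blocking student for the matching `μ`. -/
def IsBlockingStudent (p : Problem I S) (μ : Matching I p.cap) (i : I) : Prop :=
  ∃ s, Blocks p μ i s

open Classical in
/-- The problem `(P', P₋ᵢ, ≻, q)` in which student `i` reports `P'` instead of `Pᵢ`. -/
noncomputable def Problem.misreport (p : Problem I S) (i : I)
    (P' : StrictRanking (Option S)) : Problem I S :=
  { p with pref := Function.update p.pref i P' }

/-- Student `i` is a manipulating student of the mechanism `φ` at the problem `p`. -/
def IsManipulatingStudent (φ : Mechanism I S) (p : Problem I S) (i : I) : Prop :=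
  ∃ P' : StrictRanking (Option S),
    (p.pref i).rel ((φ (p.misreport i P')).assign i) ((φ p).assign i)

end Stability

section Truncation

variable {I S : Type*}

/-- School `s` is one of the (at most) `k` most-preferred acceptable schools under `P`. -/
def Listed (P : StrictRanking (Option S)) (k : ℕ) (s : S) : Prop :=
  Acceptable P s ∧ {t : S | P.rel (some t) (some s)}.ncard < k

/-- The order of the truncation: schools are ordered as in `P`, and exactly the `k`
most-preferred acceptable schools (all of them, if there are fewer) are above `none`. -/
def truncRel (P : StrictRanking (Option S)) (k : ℕ) : Option S → Option S → Prop
  | some s, some t => P.rel (some s) (some t)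
  | some s, none => Listed P k s
  | none, some s => ¬ Listed P k s
  | none, none => False

theorem Listed.of_rel [Finite S] {P : StrictRanking (Option S)} {k : ℕ} {s t : S}
    (h : P.rel (some s) (some t)) (ht : Listed P k t) : Listed P k s := by
  have := P.strictTotal
  refine ⟨_root_.trans h ht.1, lt_of_le_of_lt (Set.ncard_le_ncard ?_ (Set.toFinite _)) ht.2⟩
  intro u hu
  exact _root_.trans (r := P.rel) hu h

theorem truncRel_strictTotal [Finite S] (P : StrictRanking (Option S)) (k : ℕ) :
    IsStrictTotalOrder (Option S) (truncRel P k) := by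
  have := P.strictTotal
  refine { trichotomous := ?_, irrefl := ?_, trans := ?_ }
  · rintro (_ | a) (_ | b) h1 h2
    · rfl
    · exact absurd h2 (by simpa [truncRel] using h1)
    · exact absurd h1 (by simpa [truncRel] using h2)
    · exact Std.Trichotomous.trichotomous (r := P.rel) _ _ h1 h2
  · rintro (_ | a)
    · exact id
    · exact irrefl_of P.rel _
  · rintro (_ | a) (_ | b) (_ | c) hab hbc
    · exact hab
    · exact hab.elim
    · exact hab hbc
    · exact fun h => hab (Listed.of_rel hbc h)
    · exact hab
    · rcases trichotomous_of P.rel (some a) (some c) with h | h | h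
      · exact h
      · cases h
        exact (hbc hab).elim
      · exact (hbc (Listed.of_rel h hab)).elim
    · exact Listed.of_rel hab hbc
    · exact _root_.trans (r := P.rel) hab hbc

/-- The truncation `P^k` of `P` after the `k`-th acceptable school. -/
def StrictRanking.truncate [Finite S] (P : StrictRanking (Option S)) (k : ℕ) :
    StrictRanking (Option S) :=
  ⟨truncRel P k, truncRel_strictTotal P k⟩

/-- The problem `(P^k, ≻, q)`. -/
def Problem.truncate [Finite S] (p : Problem I S) (k : ℕ) : Problem I S :=
  { p with pref := fun i => (p.pref i).truncate k }

/-- The constrained version `φ^k` of the mechanism `φ`. -/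
def Mechanism.constrained [Finite S] (φ : Mechanism I S) (k : ℕ) : Mechanism I S :=
  fun p => φ (p.truncate k)

end Truncation

section Algorithms

variable {I S : Type*}

/-- The `n` highest-priority students of the pool `C` (all of `C`, if it has at most `n`
members). -/
def selectBest (r : StrictRanking I) (n : ℕ) (C : Set I) : Set I :=
  {i | i ∈ C ∧ {j | j ∈ C ∧ r.rel j i}.ncard < n}

open Classical in
/-- The most-preferred acceptable school outside the set `R`, or `none` if there is none. -/
noncomputable def bestOutside (P : StrictRanking (Option S)) (R : Set S) : Option S :=
  if h : ∃ s, (Acceptable P s ∧ s ∉ R) ∧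
      ∀ t, Acceptable P t → t ∉ R → t ≠ s → P.rel (some s) (some t)
  then some h.choose else none

/-- The state of an algorithm after some step: the school that currently holds
(has accepted) student `i`, if any, and the set of schools that have rejected `i` so far. -/
@[ext] structure State (I S : Type*) where
  held : I → Option S
  rejected : I → Set S

/-- Before the first step nobody is accepted and nobody has been rejected. -/
def State.start : State I S := ⟨fun _ => none, fun _ => ∅⟩

/-- The school to which student `i` newly applies: a student who is held nowhere applies to her
most-preferred acceptable school among those which have not yet rejected her (if any). -/
noncomputable def State.application (p : Problem I S) (st : State I S) (i : I) : Option S :=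
  match st.held i with
  | some _ => none
  | none => bestOutside (p.pref i) (st.rejected i)

/-- Deferred acceptance: school `s` considers the students it holds and its new applicants. -/
def State.poolGS (p : Problem I S) (st : State I S) (s : S) : Set I :=
  {i | st.held i = some s} ∪ {i | st.application p i = some s}

/-- Deferred acceptance: the students whom school `s` tentatively accepts at the next step. -/
def State.acceptGS (p : Problem I S) (st : State I S) (s : S) : Set I :=
  selectBest (p.prio s) (p.cap s) (st.poolGS p s)

open Classical in
/-- One step of the student-proposing deferred acceptance algorithm. -/
noncomputable def State.stepGS (p : Problem I S) (st : State I S) : State I S where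
  held i := if h : ∃ s, i ∈ st.acceptGS p s then some h.choose else none
  rejected i := st.rejected i ∪ {s | i ∈ st.poolGS p s ∧ i ∉ st.acceptGS p s}

/-- Immediate acceptance: the new applicants of school `s`. -/
def State.poolBoston (p : Problem I S) (st : State I S) (s : S) : Set I :=
  {i | st.application p i = some s}

/-- Immediate acceptance: the remaining capacity of school `s`. -/
noncomputable def State.seatsLeft (p : Problem I S) (st : State I S) (s : S) : ℕ :=
  p.cap s - {i | st.held i = some s}.ncard

/-- Immediate acceptance: the new applicants whom school `s` accepts at the next step. -/
def State.acceptBoston (p : Problem I S) (st : State I S) (s : S) : Set I :=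
  selectBest (p.prio s) (st.seatsLeft p s) (st.poolBoston p s)

open Classical in
/-- One step of the immediate acceptance (Boston) algorithm. Acceptances are final. -/
noncomputable def State.stepBoston (p : Problem I S) (st : State I S) : State I S where
  held i := match st.held i with
    | some s => some s
    | none => if h : ∃ s, i ∈ st.acceptBoston p s then some h.choose else none
  rejected i := st.rejected i ∪ {s | i ∈ st.poolBoston p s ∧ i ∉ st.acceptBoston p s}

/-- The state of deferred acceptance after `n` steps. -/
noncomputable def stateGS (p : Problem I S) (n : ℕ) : State I S :=
  (State.stepGS p)^[n] State.start

/-- The state of immediate acceptance after `n` steps. -/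
noncomputable def stateBoston (p : Problem I S) (n : ℕ) : State I S :=
  (State.stepBoston p)^[n] State.start

/-- A number of steps after which both algorithms have stopped
(see `stateGS_stopped` and `stateBoston_stopped`). -/
noncomputable def numSteps (I S : Type*) : ℕ := Nat.card I * Nat.card S + 1

end Algorithms

section Facts

variable {I S : Type*}

theorem ncard_selectBest_le [Finite I] (r : StrictRanking I) (n : ℕ) (C : Set I) :
    (selectBest r n C).ncard ≤ n := by
  have := r.strictTotal
  classical
  by_contra! hlt
  have hne : (selectBest r n C).Nonempty := by
    rw [← Set.ncard_pos (Set.toFinite _)]; omega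
  obtain ⟨m, hm, hmin⟩ := (Finite.wellFounded_of_trans_of_irrefl (Function.swap r.rel)).has_min
    (selectBest r n C) hne
  have hsub : selectBest r n C \ {m} ⊆ {j | j ∈ C ∧ r.rel j m} := by
    rintro j ⟨hj, hjm⟩
    refine ⟨hj.1, ?_⟩
    rcases trichotomous_of r.rel j m with h | h | h
    · exact h
    · exact absurd h hjm
    · exact absurd h (hmin j hj)
  have h1 := Set.ncard_le_ncard hsub (Set.toFinite _)
  have h2 := Set.ncard_sdiff_singleton_of_mem hm
  have h3 := hm.2
  omega

theorem poolGS_unique {p : Problem I S} {st : State I S} {i : I} {s t : S}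
    (hs : i ∈ st.poolGS p s) (ht : i ∈ st.poolGS p t) : s = t := by
  simp only [State.poolGS, State.application, Set.mem_union, Set.mem_ofPred_eq] at hs ht
  cases h : st.held i <;> simp_all

theorem stepGS_held {p : Problem I S} {st : State I S} {i : I} {s : S} :
    (st.stepGS p).held i = some s ↔ i ∈ st.acceptGS p s := by
  simp only [State.stepGS]
  split_ifs with h
  · rw [Option.some.injEq]
    refine ⟨fun e => e ▸ h.choose_spec, fun hs => poolGS_unique h.choose_spec.1 hs.1⟩
  · simp only [false_iff]
    exact fun hs => h ⟨s, hs⟩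

theorem stepBoston_held {p : Problem I S} {st : State I S} {i : I} {s : S} :
    (st.stepBoston p).held i = some s ↔ st.held i = some s ∨ i ∈ st.acceptBoston p s := by
  cases hi : st.held i with
  | some t =>
    simp [State.stepBoston, hi, State.acceptBoston, selectBest, State.poolBoston,
      State.application]
  | none =>
    simp only [State.stepBoston, hi]
    split_ifs with h
    · simp only [Option.some.injEq, false_or]
      refine ⟨fun e => e ▸ h.choose_spec, fun hs => ?_⟩
      have h1 : st.application p i = some h.choose := h.choose_spec.1
      have h2 : st.application p i = some s := hs.1
      simpa [h1] using h2
    · simp only [false_or, false_iff]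
      exact fun hs => h ⟨s, hs⟩

theorem stateGS_capacity [Finite I] (p : Problem I S) (n : ℕ) (s : S) :
    {i | (stateGS p n).held i = some s}.ncard ≤ p.cap s := by
  cases n with
  | zero => simp [stateGS, State.start]
  | succ n =>
    simp only [stateGS, Function.iterate_succ_apply', stepGS_held]
    exact ncard_selectBest_le _ _ _

theorem stateBoston_capacity [Finite I] (p : Problem I S) (n : ℕ) (s : S) :
    {i | (stateBoston p n).held i = some s}.ncard ≤ p.cap s := by
  induction n with
  | zero => simp [stateBoston, State.start]
  | succ n ih =>
    have h1 : (stateBoston p (n + 1)) = (stateBoston p n).stepBoston p := by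
      simp only [stateBoston, Function.iterate_succ_apply']
    have h2 : {i | (stateBoston p (n + 1)).held i = some s} =
        {i | (stateBoston p n).held i = some s} ∪ (stateBoston p n).acceptBoston p s := by
      ext i
      simp only [h1, stepBoston_held, Set.mem_union, Set.mem_ofPred_eq]
    rw [h2]
    refine (Set.ncard_union_le _ _).trans ?_
    have h3 : ((stateBoston p n).acceptBoston p s).ncard ≤ (stateBoston p n).seatsLeft p s :=
      ncard_selectBest_le _ _ _
    simp only [State.seatsLeft] at h3
    omega

/-- Once a step of deferred acceptance rejects nobody, the state no longer changes. -/
theorem stepGS_stepGS {p : Problem I S} {st : State I S}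
    (h : ∀ i s, i ∈ st.poolGS p s → i ∈ st.acceptGS p s) :
    (st.stepGS p).stepGS p = st.stepGS p := by
  have hrej : (st.stepGS p).rejected = st.rejected := by
    funext i
    simp only [State.stepGS]
    refine Set.union_eq_left.2 ?_
    rintro s ⟨h1, h2⟩
    exact absurd (h i s h1) h2
  have hheld : ∀ i s, (st.stepGS p).held i = some s ↔ i ∈ st.poolGS p s := fun i s =>
    stepGS_held.trans ⟨fun hs => hs.1, h i s⟩
  have hpool : (st.stepGS p).poolGS p = st.poolGS p := by
    funext s
    ext i
    simp only [State.poolGS, Set.mem_union, Set.mem_ofPred_eq]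
    rw [hheld]
    refine ⟨?_, fun hs => Or.inl hs⟩
    rintro (hs | hs)
    · exact hs
    · exfalso
      simp only [State.application, hrej] at hs
      cases hi : (st.stepGS p).held i with
      | some t => simp [hi] at hs
      | none =>
        simp only [hi] at hs
        have hno : ∀ t, i ∉ st.poolGS p t := fun t ht => by simp [(hheld i t).2 ht] at hi
        cases hi' : st.held i with
        | some t => exact hno t (Or.inl hi')
        | none => exact hno s (Or.inr (by simpa [State.application, hi'] using hs))
  have hacc : (st.stepGS p).acceptGS p = st.acceptGS p := by
    funext s
    simp only [State.acceptGS, hpool]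
  ext i s
  · rw [stepGS_held, stepGS_held, hacc]
  · change s ∈ (st.stepGS p).rejected i ∪ _ ↔ s ∈ st.rejected i ∪ _
    rw [hrej, hpool, hacc]

theorem bestOutside_notMem {P : StrictRanking (Option S)} {R : Set S} {s : S}
    (h : bestOutside P R = some s) : s ∉ R := by
  unfold bestOutside at h
  split_ifs at h with h'
  cases h
  exact h'.choose_spec.1.2

theorem application_eq_some {p : Problem I S} {st : State I S} {i : I} {s : S}
    (h : st.application p i = some s) : st.held i = none ∧ s ∉ st.rejected i := by
  unfold State.application at h
  cases hi : st.held i with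
  | some t => simp [hi] at h
  | none =>
    simp only [hi] at h
    exact ⟨rfl, bestOutside_notMem h⟩

/-- If a map on a type either fixes the state it reaches or enlarges a subset of a finite type,
then its iterates are eventually constant. -/
theorem iterate_stopped {A B : Type*} [Finite B] (f : A → A) (m : A → Set B) (inv : A → Prop)
    (hinv : ∀ a, inv a → inv (f a))
    (hf : ∀ a, inv a → f (f a) = f a ∨ m a ⊂ m (f a)) (a : A) (ha : inv a) :
    f (f^[Nat.card B + 1] a) = f^[Nat.card B + 1] a := by
  have key : ∀ n, inv (f^[n] a) ∧ (f (f^[n] a) = f^[n] a ∨ n ≤ (m (f^[n] a)).ncard) := by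
    intro n
    induction n with
    | zero => exact ⟨ha, Or.inr (Nat.zero_le _)⟩
    | succ n ih =>
      obtain ⟨h1, h2⟩ := ih
      rw [Function.iterate_succ_apply']
      refine ⟨hinv _ h1, ?_⟩
      rcases h2 with h2 | h2
      · left; rw [h2, h2]
      · rcases hf _ h1 with h3 | h3
        · exact Or.inl h3
        · right
          have := Set.ncard_lt_ncard h3 (Set.toFinite _)
          omega
  rcases (key (Nat.card B + 1)).2 with h | h
  · exact h
  · have := Set.ncard_le_card (m (f^[Nat.card B + 1] a))
    omega

/-- Deferred acceptance has stopped after `numSteps I S` steps. -/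
theorem stateGS_stopped [Finite I] [Finite S] (p : Problem I S) :
    (stateGS p (numSteps I S)).stepGS p = stateGS p (numSteps I S) := by
  have h := iterate_stopped (B := I × S) (State.stepGS p)
    (fun st => {x | x.2 ∈ st.rejected x.1})
    (fun st => ∀ i s, st.held i = some s → s ∉ st.rejected i) ?_ ?_ State.start
    (by simp [State.start])
  · rwa [Nat.card_prod] at h
  · intro st hst i s hs hr
    rw [stepGS_held] at hs
    rcases hr with hr | hr
    · rcases hs.1 with h1 | h1
      · exact hst i s h1 hr
      · exact (application_eq_some h1).2 hr
    · exact hr.2 hs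
  · intro st hst
    by_cases hall : ∀ i s, i ∈ st.poolGS p s → i ∈ st.acceptGS p s
    · exact Or.inl (stepGS_stepGS hall)
    · right
      push Not at hall
      obtain ⟨i, s, h1, h2⟩ := hall
      refine Set.ssubset_iff_exists.2 ⟨fun x hx => Or.inl hx, (i, s), Or.inr ⟨h1, h2⟩, ?_⟩
      rcases h1 with h1 | h1
      · exact hst i s h1
      · exact (application_eq_some h1).2

/-- Immediate acceptance has stopped after `numSteps I S` steps. -/
theorem stateBoston_stopped [Finite I] [Finite S] (p : Problem I S) :
    (stateBoston p (numSteps I S)).stepBoston p = stateBoston p (numSteps I S) := by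
  have h := iterate_stopped (B := I × S) (State.stepBoston p)
    (fun st => {x | x.2 ∈ st.rejected x.1 ∨ st.held x.1 = some x.2})
    (fun _ => True) (fun _ _ => trivial) ?_ State.start trivial
  · rwa [Nat.card_prod] at h
  · intro st _
    by_cases hall : ∀ i s, i ∉ st.poolBoston p s
    · left
      have hacc : ∀ i s, i ∉ st.acceptBoston p s := fun i s hs => hall i s hs.1
      have : st.stepBoston p = st := by
        ext i s
        · rw [stepBoston_held]
          simp [hacc]
        · simp [State.stepBoston, hall]
      rw [this, this]
    · right
      push Not at hall
      obtain ⟨i, s, h1⟩ := hall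
      have h0 := application_eq_some h1
      refine Set.ssubset_iff_exists.2 ⟨?_, (i, s), ?_, ?_⟩
      · rintro x (hx | hx)
        · exact Or.inl (Or.inl hx)
        · exact Or.inr (stepBoston_held.2 (Or.inl hx))
      · by_cases h2 : i ∈ st.acceptBoston p s
        · exact Or.inr (stepBoston_held.2 (Or.inr h2))
        · exact Or.inl (Or.inr ⟨h1, h2⟩)
      · rintro (h2 | h2)
        · exact h0.2 h2
        · simp [h0.1] at h2

end Facts

section Mechanisms

variable {I S : Type*}

/-- The Gale-Shapley mechanism: the outcome of student-proposing deferred acceptance. -/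
noncomputable def galeShapley [Finite I] : Mechanism I S := fun p =>
  ⟨(stateGS p (numSteps I S)).held, stateGS_capacity p _⟩

/-- The Boston mechanism: the outcome of immediate acceptance. -/
noncomputable def boston [Finite I] : Mechanism I S := fun p =>
  ⟨(stateBoston p (numSteps I S)).held, stateBoston_capacity p _⟩

end Mechanisms

end SchoolChoice

/-!
Both halves rest on the remark that a pair `(i, s)` cannot block a matching in which `s` is filled
by students ranked above `i` (`not_blocks_of_cap_le`), and on the fact that a pool which contains
`n` students ranked above `i` still has `n` such students after `selectBest` has cut it down to its
best `n` members (`le_ncard_selectBest`).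

*Boston.* The acceptances of the first step are final. So if `(i, s)` blocks the outcome, fewer than
`q s` of the students whose first choice is `s` are ranked above `i`. A student `i` who moves `s` to
the top of her list is then accepted by `s` in the first step, and this is an improvement for her.

*Gale-Shapley.* The main tool is `not_rel_of_unmatched`, a form of the rural hospitals theorem: if
`i` is unmatched in a stable matching `μ`, then no matching `ν` that is unblocked by the *other*
students gives `i` an acceptable school. Indeed, let `A` be the set of students who are better off
at `ν` than at `μ`. Stability implies that every school has at least as many students from `A` at
`μ` as at `ν`. All students of `A` are matched at `ν`, hence by counting also at `μ`, and so `i` is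
not in `A`.

Since the behaviour of `i` in `ν` is unrestricted, `ν` can be the outcome of any misreport of `i`.
If `i` is unmatched at the outcome `μ` of the constrained mechanism and does not block it under her
true preferences, then `μ` is stable when her truncated list is replaced by the true one, and the
tool shows that she cannot manipulate. If `i` is matched at `μ`, then the truncation is immaterial
for what she likes better than `μ`, and it remains to show that deferred acceptance is
strategy-proof (`galeShapley_strategyProof`). For this, let her list end just above her assignment.
She becomes unmatched, because `μ` is optimal for students among the stable matchings, and the tool
applies again.
-/

namespace SchoolChoice

variable {I S : Type*}

/-! ### Selection from a pool -/

/-- If `C` contains `n` members above `i`, then so does the set of its best `n` members. -/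
theorem le_ncard_selectBest [Finite I] (r : StrictRanking I) (n : ℕ) (C : Set I) (i : I)
    (h : n ≤ {j | j ∈ C ∧ r.rel j i}.ncard) :
    n ≤ {j | j ∈ selectBest r n C ∧ r.rel j i}.ncard := by
  have := r.strictTotal
  induction i using (Finite.wellFounded_of_trans_of_irrefl r.rel).induction with
  | _ i ih =>
    by_cases hsub : ∀ j, j ∈ C → r.rel j i → j ∈ selectBest r n C
    · exact h.trans (Set.ncard_le_ncard (fun j hj => ⟨hsub j hj.1 hj.2, hj.2⟩) (Set.toFinite _))
    · push Not at hsub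
      obtain ⟨d, hdC, hdi, hd⟩ := hsub
      have hd' : n ≤ {j | j ∈ C ∧ r.rel j d}.ncard := by
        by_contra hlt
        exact hd ⟨hdC, not_le.1 hlt⟩
      exact (ih d hdi hd').trans
        (Set.ncard_le_ncard (fun j hj => ⟨hj.1, _root_.trans hj.2 hdi⟩) (Set.toFinite _))

theorem bestOutside_eq_some {P : StrictRanking (Option S)} {R : Set S} {s : S} :
    bestOutside P R = some s ↔ Acceptable P s ∧ s ∉ R ∧
      ∀ t, Acceptable P t → t ∉ R → t ≠ s → P.rel (some s) (some t) := by
  have := P.strictTotal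
  unfold bestOutside
  split_ifs with h
  · have hc := h.choose_spec
    rw [Option.some.injEq]
    constructor
    · intro e
      rw [← e]
      exact ⟨hc.1.1, hc.1.2, hc.2⟩
    · rintro ⟨h1, h2, h3⟩
      by_contra hne
      exact asymm_of P.rel (h3 _ hc.1.1 hc.1.2 hne) (hc.2 _ h1 h2 (Ne.symm hne))
  · simp only [false_iff]
    rintro ⟨h1, h2, h3⟩
    exact h ⟨s, ⟨h1, h2⟩, h3⟩

theorem mem_of_bestOutside_eq_none [Finite S] {P : StrictRanking (Option S)} {R : Set S}
    (h : bestOutside P R = none) {s : S} (hs : Acceptable P s) : s ∈ R := by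
  have := P.strictTotal
  by_contra hsR
  let r : S → S → Prop := fun a b => P.rel (some a) (some b)
  have : IsTrans S r := ⟨fun a b c hab hbc => _root_.trans (r := P.rel) hab hbc⟩
  have : Std.Irrefl r := ⟨fun a => irrefl_of P.rel _⟩
  obtain ⟨m, hm, hmin⟩ := (Finite.wellFounded_of_trans_of_irrefl r).has_min
    {t | Acceptable P t ∧ t ∉ R} ⟨s, hs, hsR⟩
  have hbest : bestOutside P R = some m := bestOutside_eq_some.2 ⟨hm.1, hm.2, fun t h1 h2 h3 => by
    rcases trichotomous_of P.rel (some m) (some t) with h | h | h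
    · exact h
    · exact absurd (Option.some.inj h).symm h3
    · exact absurd h (hmin t ⟨h1, h2⟩)⟩
  simp [h] at hbest

/-! ### Stable matchings -/

/-- A matching is stable if no student prefers the outside option to her assignment, and there is
no blocking pair. -/
structure IsStable (p : Problem I S) (μ : Matching I p.cap) : Prop where
  not_rel_none : ∀ i, ¬ (p.pref i).rel none (μ.assign i)
  not_blocks : ∀ i s, ¬ Blocks p μ i s

/-- A school filled with students ranked above `i` forms no blocking pair with `i`. -/
theorem not_blocks_of_cap_le [Finite I] {p : Problem I S} {μ : Matching I p.cap} {i : I} {s : S}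
    (h : p.cap s ≤ {j | μ.assign j = some s ∧ (p.prio s).rel j i}.ncard) : ¬ Blocks p μ i s := by
  have := (p.prio s).strictTotal
  have hcap := μ.capacity s
  have heq : {j | μ.assign j = some s ∧ (p.prio s).rel j i} = {j | μ.assign j = some s} :=
    Set.eq_of_subset_of_ncard_le (fun j hj => hj.1) (hcap.trans h) (Set.toFinite _)
  rintro ⟨-, ⟨j, hj, hij⟩ | hlt⟩
  · have hj' : j ∈ {j | μ.assign j = some s ∧ (p.prio s).rel j i} := heq ▸ hj
    exact asymm_of (p.prio s).rel hij hj'.2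
  · rw [heq] at h
    omega

/-- A student who is unmatched in a stable matching gets no acceptable school in any matching that
is unblocked by the other students. -/
theorem not_rel_of_unmatched [Finite I] [Finite S] {p : Problem I S} {μ ν : Matching I p.cap}
    {i : I} (hμ : IsStable p μ) (hν : ∀ j, j ≠ i → ∀ s, ¬ Blocks p ν j s)
    (hi : μ.assign i = none) : ¬ (p.pref i).rel (ν.assign i) none := by
  intro hacc
  have hst := fun j => (p.pref j).strictTotal
  have hso := fun s => (p.prio s).strictTotal
  let A : Set I := {j | (p.pref j).rel (ν.assign j) (μ.assign j)}
  have hiA : i ∈ A := by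
    change (p.pref i).rel _ _
    rwa [hi]
  -- Every school has at least as many students from `A` at `μ` as at `ν`.
  have hschool : ∀ s, {j | j ∈ A ∧ ν.assign j = some s}.ncard ≤
      {j | j ∈ A ∧ μ.assign j = some s}.ncard := by
    intro s
    rcases Set.eq_empty_or_nonempty {j | j ∈ A ∧ ν.assign j = some s} with he | ⟨a, haA, has⟩
    · simp [he]
    have hab := hμ.not_blocks a s
    have hpref : (p.pref a).rel (some s) (μ.assign a) := has ▸ haA
    have hfull : p.cap s ≤ {j | μ.assign j = some s}.ncard := by
      by_contra hlt
      exact hab ⟨hpref, Or.inr (not_le.1 hlt)⟩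
    have hsub : {j | μ.assign j = some s} \ {j | ν.assign j = some s} ⊆
        {j | j ∈ A ∧ μ.assign j = some s} := by
      rintro b ⟨hb1 : μ.assign b = some s, hb2 : ν.assign b ≠ some s⟩
      refine ⟨?_, hb1⟩
      rcases trichotomous_of (p.pref b).rel (ν.assign b) (μ.assign b) with h | h | h
      · exact h
      · exact absurd (h.trans hb1) hb2
      · -- Otherwise `a` and `b` are each ranked above the other by `s`.
        exfalso
        have hbi : b ≠ i := by
          rintro rfl
          simp [hi] at hb1
        have hnba : ¬ (p.prio s).rel b a := fun hba => hν b hbi s ⟨hb1 ▸ h, Or.inl ⟨a, has, hba⟩⟩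
        have hnab : ¬ (p.prio s).rel a b := fun hba => hab ⟨hpref, Or.inl ⟨b, hb1, hba⟩⟩
        rcases trichotomous_of (p.prio s).rel a b with h' | h' | h'
        · exact hnab h'
        · exact hb2 (h' ▸ has)
        · exact hnba h'
    have hsub' : {j | j ∈ A ∧ ν.assign j = some s} ⊆
        {j | ν.assign j = some s} \ {j | μ.assign j = some s} := by
      rintro b ⟨hb1 : (p.pref b).rel _ _, hb2⟩
      refine ⟨hb2, fun hb3 : μ.assign b = some s => ?_⟩
      rw [hb2, hb3] at hb1
      exact irrefl_of (p.pref b).rel _ hb1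
    have h1 := Set.ncard_le_ncard hsub (Set.toFinite _)
    have h2 := Set.ncard_le_ncard hsub' (Set.toFinite _)
    have h3 := Set.ncard_inter_add_ncard_sdiff_eq_ncard {j | ν.assign j = some s}
      {j | μ.assign j = some s} (Set.toFinite _)
    have h4 := Set.ncard_inter_add_ncard_sdiff_eq_ncard {j | μ.assign j = some s}
      {j | ν.assign j = some s} (Set.toFinite _)
    rw [Set.inter_comm] at h4
    have h5 := ν.capacity s
    omega
  classical
  have := Fintype.ofFinite I
  have := Fintype.ofFinite S
  have hcount : ∀ f : I → Option S, {j | j ∈ A ∧ f j ≠ none}.ncard =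
      ∑ s, {j | j ∈ A ∧ f j = some s}.ncard := by
    intro f
    have hU : {j | j ∈ A ∧ f j ≠ none} = ⋃ s, {j | j ∈ A ∧ f j = some s} := by
      ext j
      simp [Option.ne_none_iff_exists']
    rw [hU, Set.ncard_iUnion_of_finite (fun _ => Set.toFinite _), finsum_eq_sum_of_fintype]
    intro s t hst
    refine Set.disjoint_left.2 fun j h1 h2 => hst ?_
    exact Option.some.inj (h1.2.symm.trans h2.2)
  have hle : {j | j ∈ A ∧ ν.assign j ≠ none}.ncard ≤ {j | j ∈ A ∧ μ.assign j ≠ none}.ncard := by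
    rw [hcount, hcount]
    exact Finset.sum_le_sum fun s _ => hschool s
  have hA : A ⊆ {j | j ∈ A ∧ ν.assign j ≠ none} := fun j hj =>
    ⟨hj, fun h => hμ.not_rel_none j (h ▸ hj)⟩
  have hlt : {j | j ∈ A ∧ μ.assign j ≠ none}.ncard < A.ncard :=
    Set.ncard_lt_ncard
      (Set.ssubset_iff_exists.2 ⟨fun j hj => hj.1, i, hiA, fun h => h.2 hi⟩) (Set.toFinite _)
  have := Set.ncard_le_ncard hA (Set.toFinite _)
  omega

/-! ### Deferred acceptance -/

theorem stateGS_succ (p : Problem I S) (n : ℕ) :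
    stateGS p (n + 1) = (stateGS p n).stepGS p := by
  simp only [stateGS, Function.iterate_succ_apply']

theorem mem_stepGS_rejected {p : Problem I S} {st : State I S} {i : I} {s : S} :
    s ∈ (st.stepGS p).rejected i ↔
      s ∈ st.rejected i ∨ i ∈ st.poolGS p s ∧ i ∉ st.acceptGS p s := Iff.rfl

/-- A student who is held by a school is held by her best school among those that have not
rejected her. -/
theorem stateGS_bestOutside_of_held (p : Problem I S) (n : ℕ) {i : I} {s : S}
    (h : (stateGS p n).held i = some s) :
    bestOutside (p.pref i) ((stateGS p n).rejected i) = some s := by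
  induction n generalizing s with
  | zero => simp [stateGS, State.start] at h
  | succ n ih =>
    rw [stateGS_succ, stepGS_held] at h
    have hb : bestOutside (p.pref i) ((stateGS p n).rejected i) = some s := by
      rcases h.1 with h1 | h1
      · exact ih h1
      · have h2 := (application_eq_some h1).1
        have h3 : (stateGS p n).application p i = some s := h1
        simpa [State.application, h2] using h3
    rw [bestOutside_eq_some] at hb ⊢
    rw [stateGS_succ]
    refine ⟨hb.1, ?_, fun t h1 h2 h3 => hb.2.2 t h1 (fun h4 => h2 (Or.inl h4)) h3⟩
    rw [mem_stepGS_rejected]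
    rintro (h1 | h1)
    · exact hb.2.1 h1
    · exact h1.2 h

theorem mem_poolGS_stateGS {p : Problem I S} {n : ℕ} {i : I} {s : S} :
    i ∈ (stateGS p n).poolGS p s ↔
      bestOutside (p.pref i) ((stateGS p n).rejected i) = some s := by
  simp only [State.poolGS, State.application, Set.mem_union, Set.mem_ofPred_eq]
  cases h : (stateGS p n).held i with
  | none => simp
  | some t => simp [stateGS_bestOutside_of_held p n h]

/-- A school that has rejected `i` is filled with students ranked above `i`, and remains so. -/
theorem cap_le_of_mem_rejected [Finite I] (p : Problem I S) (n : ℕ) {i : I} {s : S}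
    (h : s ∈ (stateGS p n).rejected i) :
    p.cap s ≤ {j | (stateGS p n).held j = some s ∧ (p.prio s).rel j i}.ncard := by
  induction n with
  | zero => simp [stateGS, State.start] at h
  | succ n ih =>
    rw [stateGS_succ] at h ⊢
    simp only [stepGS_held]
    apply le_ncard_selectBest
    rcases h with h | h
    · exact (ih h).trans
        (Set.ncard_le_ncard (fun j hj => ⟨Or.inl hj.1, hj.2⟩) (Set.toFinite _))
    · by_contra hlt
      exact h.2 ⟨h.1, not_le.1 hlt⟩

theorem galeShapley_acceptable [Finite I] {p : Problem I S} {i : I} {s : S}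
    (h : (galeShapley p).assign i = some s) : Acceptable (p.pref i) s :=
  (bestOutside_eq_some.1 (stateGS_bestOutside_of_held p _ h)).1

/-- In the outcome of deferred acceptance, a student has been rejected by every acceptable school
that she likes better than her assignment. -/
theorem mem_rejected_of_rel_galeShapley [Finite I] [Finite S] {p : Problem I S} {i : I} {s : S}
    (h : (p.pref i).rel (some s) ((galeShapley p).assign i)) :
    s ∈ (stateGS p (numSteps I S)).rejected i := by
  have := (p.pref i).strictTotal
  by_contra hs
  cases hi : (galeShapley p).assign i with
  | some t =>
    rw [hi] at h
    have hb := bestOutside_eq_some.1 (stateGS_bestOutside_of_held p _ hi)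
    have hne : s ≠ t := by
      rintro rfl
      exact irrefl_of (p.pref i).rel _ h
    exact asymm_of (p.pref i).rel h (hb.2.2 s (_root_.trans h hb.1) hs hne)
  | none =>
    rw [hi] at h
    cases hb : bestOutside (p.pref i) ((stateGS p (numSteps I S)).rejected i) with
    | none => exact hs (mem_of_bestOutside_eq_none hb h)
    | some t =>
      -- The next step would change the state: `t` would accept `i` or reject her anew.
      have hpool := mem_poolGS_stateGS.2 hb
      by_cases hacc : i ∈ (stateGS p (numSteps I S)).acceptGS p t
      · rw [← stepGS_held, stateGS_stopped] at hacc
        exact absurd (hi.symm.trans hacc) (by simp)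
      · have hrej := mem_stepGS_rejected.2 (Or.inr ⟨hpool, hacc⟩)
        rw [stateGS_stopped] at hrej
        exact bestOutside_notMem hb hrej

theorem galeShapley_isStable [Finite I] [Finite S] (p : Problem I S) :
    IsStable p (galeShapley p) where
  not_rel_none i h := by
    have := (p.pref i).strictTotal
    cases hi : (galeShapley p).assign i with
    | none =>
      rw [hi] at h
      exact irrefl_of (p.pref i).rel _ h
    | some s =>
      rw [hi] at h
      exact asymm_of (p.pref i).rel h (galeShapley_acceptable hi)
  not_blocks _ _ h := not_blocks_of_cap_le
    (cap_le_of_mem_rejected p _ (mem_rejected_of_rel_galeShapley h.1)) h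

/-- During deferred acceptance, no student is rejected by a school that she gets in some stable
matching. -/
theorem IsStable.notMem_rejected [Finite I] {p : Problem I S} {ν : Matching I p.cap}
    (hν : IsStable p ν) (n : ℕ) {i : I} {s : S} (hi : ν.assign i = some s) :
    s ∉ (stateGS p n).rejected i := by
  induction n generalizing i s with
  | zero => simp [stateGS, State.start]
  | succ n ih =>
    rw [stateGS_succ, mem_stepGS_rejected]
    rintro (h | ⟨hpool, hacc⟩)
    · exact ih hi h
    have := (p.prio s).strictTotal
    have hle : p.cap s ≤ {j | j ∈ (stateGS p n).poolGS p s ∧ (p.prio s).rel j i}.ncard := by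
      by_contra hlt
      exact hacc ⟨hpool, not_le.1 hlt⟩
    -- As `i` takes a seat of `s` at `ν`, one of the students preferred to her goes elsewhere.
    obtain ⟨j, ⟨hjpool, hji⟩, hjs⟩ :
        ∃ j ∈ {j | j ∈ (stateGS p n).poolGS p s ∧ (p.prio s).rel j i}, ν.assign j ≠ some s := by
      by_contra! hall
      have hlt : {j | j ∈ (stateGS p n).poolGS p s ∧ (p.prio s).rel j i}.ncard <
          {j | ν.assign j = some s}.ncard := by
        refine Set.ncard_lt_ncard (Set.ssubset_iff_exists.2 ⟨hall, i, hi, ?_⟩) (Set.toFinite _)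
        exact fun h => irrefl_of (p.prio s).rel _ h.2
      have := ν.capacity s
      omega
    have hb := bestOutside_eq_some.1 (mem_poolGS_stateGS.1 hjpool)
    refine hν.not_blocks j s ⟨?_, Or.inl ⟨i, hi, hji⟩⟩
    have := (p.pref j).strictTotal
    cases hj : ν.assign j with
    | none => exact hb.1
    | some t =>
      refine hb.2.2 t ?_ (ih hj) (fun h => hjs (h ▸ hj))
      have hir := hν.not_rel_none j
      rw [hj] at hir
      rcases trichotomous_of (p.pref j).rel (some t) none with h | h | h
      · exact h
      · simp at h
      · exact absurd h hir

/-- Deferred acceptance is optimal for the students among the stable matchings. -/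
theorem IsStable.not_rel_galeShapley [Finite I] [Finite S] {p : Problem I S}
    {ν : Matching I p.cap} (hν : IsStable p ν) (i : I) :
    ¬ (p.pref i).rel (ν.assign i) ((galeShapley p).assign i) := by
  intro h
  cases hi : ν.assign i with
  | none => exact (galeShapley_isStable p).not_rel_none i (hi ▸ h)
  | some s => exact hν.notMem_rejected _ hi (mem_rejected_of_rel_galeShapley (hi ▸ h))

/-! ### Strategy-proofness -/

@[simp] theorem misreport_pref_self (p : Problem I S) (i : I) (P : StrictRanking (Option S)) :
    (p.misreport i P).pref i = P := by
  simp [Problem.misreport]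

theorem misreport_pref_of_ne (p : Problem I S) {i j : I} (h : j ≠ i)
    (P : StrictRanking (Option S)) : (p.misreport i P).pref j = p.pref j := by
  simp [Problem.misreport, h]

/-- Whether a student other than `i` blocks a matching does not depend on the report of `i`. -/
theorem blocks_misreport_of_ne {p : Problem I S} {i j : I} (h : j ≠ i)
    {P : StrictRanking (Option S)} {μ : Matching I p.cap} {s : S} :
    Blocks (p.misreport i P) μ j s ↔ Blocks p μ j s := by
  unfold Blocks
  rw [misreport_pref_of_ne p h]
  rfl

theorem listed_ncard_iff [Finite S] {P : StrictRanking (Option S)} {m : S} (hm : Acceptable P m)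
    (t : S) :
    Listed P {u : S | P.rel (some u) (some m)}.ncard t ↔ P.rel (some t) (some m) := by
  have := P.strictTotal
  refine ⟨fun h => ?_, fun h => ⟨_root_.trans h hm, ?_⟩⟩
  · rcases trichotomous_of P.rel (some t) (some m) with h' | h' | h'
    · exact h'
    · cases h'
      exact absurd h.2 (lt_irrefl _)
    · exact absurd h.2 (not_lt.2 (Set.ncard_le_ncard
        (fun u hu => _root_.trans (r := P.rel) hu h') (Set.toFinite _)))
  · exact Set.ncard_lt_ncard (Set.ssubset_iff_exists.2
      ⟨fun u hu => _root_.trans (r := P.rel) hu h, t, h, irrefl_of P.rel _⟩) (Set.toFinite _)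

/-- Deferred acceptance is strategy-proof. More generally, `i` prefers no matching that is
unblocked by the other students to the outcome of deferred acceptance. -/
theorem galeShapley_strategyProof [Finite I] [Finite S] {p : Problem I S} {i : I}
    {ν : Matching I p.cap} (hν : ∀ j, j ≠ i → ∀ s, ¬ Blocks p ν j s) :
    ¬ (p.pref i).rel (ν.assign i) ((galeShapley p).assign i) := by
  intro h
  have := (p.pref i).strictTotal
  cases hm : (galeShapley p).assign i with
  | none =>
    rw [hm] at h
    exact not_rel_of_unmatched (galeShapley_isStable p) hν hm h
  | some m =>
    rw [hm] at h
    have hacc := galeShapley_acceptable hm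
    cases hs : ν.assign i with
    | none =>
      rw [hs] at h
      exact asymm_of (p.pref i).rel h hacc
    | some s =>
      rw [hs] at h
      -- The list of `i` is cut off just above `m`.
      let P := (p.pref i).truncate {u : S | (p.pref i).rel (some u) (some m)}.ncard
      let μ : Matching I p.cap := galeShapley (p.misreport i P)
      have hμ : IsStable (p.misreport i P) μ := galeShapley_isStable _
      have hμi : μ.assign i = none := by
        by_contra hne
        obtain ⟨t, ht⟩ := Option.ne_none_iff_exists'.1 hne
        have htl : Acceptable P t := by
          simpa using galeShapley_acceptable (p := p.misreport i P) ht
        have htm : (p.pref i).rel (some t) (some m) := (listed_ncard_iff hacc t).1 htl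
        -- Now `μ` is stable for the full list as well, against the optimality of `m`.
        have hμ' : IsStable p μ := by
          refine ⟨fun j => ?_, fun j u hb => ?_⟩
          · by_cases hj : j = i
            · subst hj
              rw [ht]
              exact asymm_of (p.pref j).rel (_root_.trans htm hacc)
            · rw [← misreport_pref_of_ne p hj P]
              exact hμ.not_rel_none j
          · by_cases hj : j = i
            · subst hj
              refine hμ.not_blocks j u ⟨?_, hb.2⟩
              have hb1 := hb.1
              rw [ht] at hb1 ⊢
              rw [misreport_pref_self]
              exact hb1
            · exact hμ.not_blocks j u ((blocks_misreport_of_ne hj).2 hb)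
        have := hμ'.not_rel_galeShapley i
        rw [ht, hm] at this
        exact this htm
      refine not_rel_of_unmatched (p := p.misreport i P) (ν := ν) hμ
        (fun j hj u hb => hν j hj u ((blocks_misreport_of_ne hj).1 hb)) hμi ?_
      rw [hs, misreport_pref_self]
      exact (listed_ncard_iff hacc s).2 h

theorem isBlockingStudent_of_isManipulatingStudent_galeShapley [Finite I] [Finite S]
    {p : Problem I S} {k : ℕ} {i : I}
    (h : IsManipulatingStudent (galeShapley.constrained k) p i) :
    IsBlockingStudent p (galeShapley.constrained k p) i := by
  obtain ⟨P', h⟩ := h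
  by_contra hnb
  have := (p.pref i).strictTotal
  let ν : Matching I (p.truncate k).cap := galeShapley ((p.misreport i P').truncate k)
  let μ : Matching I (p.truncate k).cap := galeShapley (p.truncate k)
  change (p.pref i).rel (ν.assign i) (μ.assign i) at h
  have hν : ∀ j, j ≠ i → ∀ s, ¬ Blocks (p.truncate k) ν j s := by
    intro j hj s hb
    refine (galeShapley_isStable ((p.misreport i P').truncate k)).not_blocks j s ⟨?_, hb.2⟩
    change (((p.misreport i P').pref j).truncate k).rel _ _
    rw [misreport_pref_of_ne p hj]
    exact hb.1
  have hμ : IsStable (p.truncate k) μ := galeShapley_isStable _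
  cases hm : μ.assign i with
  | some m =>
    rw [hm] at h
    have hacc : Listed (p.pref i) k m := galeShapley_acceptable hm
    cases hs : ν.assign i with
    | none =>
      rw [hs] at h
      exact asymm_of (p.pref i).rel h hacc.1
    | some s =>
      -- Truncation does not change the order of schools.
      rw [hs] at h
      refine galeShapley_strategyProof hν ?_
      rw [hs, show (galeShapley (p.truncate k)).assign i = some m from hm]
      exact h
  | none =>
    rw [hm] at h
    -- As `i` does not block `μ`, it is stable when she reports her full list.
    have hμ' : IsStable ((p.truncate k).misreport i (p.pref i)) μ := by
      refine ⟨fun j => ?_, fun j u hb => ?_⟩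
      · by_cases hj : j = i
        · subst hj
          rw [hm, misreport_pref_self]
          exact irrefl_of (p.pref j).rel _
        · rw [misreport_pref_of_ne _ hj]
          exact hμ.not_rel_none j
      · by_cases hj : j = i
        · subst hj
          refine hnb ⟨u, ?_, hb.2⟩
          have hb1 := hb.1
          rwa [misreport_pref_self] at hb1
        · exact hμ.not_blocks j u ((blocks_misreport_of_ne hj).1 hb)
    refine not_rel_of_unmatched (p := (p.truncate k).misreport i (p.pref i)) (ν := ν) hμ'
      (fun j hj u hb => hν j hj u ((blocks_misreport_of_ne hj).1 hb)) hm ?_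
    rw [misreport_pref_self]
    exact h

/-! ### Immediate acceptance -/

/-- The acceptances of the first step are final. -/
theorem boston_assign_of_mem_selectBest [Finite I] [Finite S] {p : Problem I S} {i : I} {s : S}
    (h : i ∈ selectBest (p.prio s) (p.cap s) {j | bestOutside (p.pref j) ∅ = some s}) :
    (boston p).assign i = some s := by
  have key : ∀ n, (stateBoston p (n + 1)).held i = some s := by
    intro n
    induction n with
    | zero =>
      change (State.start.stepBoston p).held i = some s
      refine stepBoston_held.2 (Or.inr ?_)
      simpa [State.acceptBoston, State.seatsLeft, State.poolBoston, State.application,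
        State.start] using h
    | succ n ih =>
      have hsucc : stateBoston p (n + 1 + 1) = (stateBoston p (n + 1)).stepBoston p := by
        simp only [stateBoston, Function.iterate_succ_apply']
      rw [hsucc]
      exact stepBoston_held.2 (Or.inl ih)
  exact key _

/-- The ranking obtained from `P` by moving `a` to the top. -/
def StrictRanking.moveToTop {α : Type*} (P : StrictRanking α) (a : α) : StrictRanking α where
  rel x y := y ≠ a ∧ (x = a ∨ P.rel x y)
  strictTotal := by
    have := P.strictTotal
    refine { trichotomous := ?_, irrefl := ?_, trans := ?_ }
    · intro x y h1 h2
      by_cases hx : x = a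
      · by_cases hy : y = a
        · rw [hx, hy]
        · exact absurd ⟨hy, Or.inl hx⟩ h1
      · by_cases hy : y = a
        · exact absurd ⟨hx, Or.inl hy⟩ h2
        · exact Std.Trichotomous.trichotomous (r := P.rel) _ _ (fun h => h1 ⟨hy, Or.inr h⟩)
            (fun h => h2 ⟨hx, Or.inr h⟩)
    · rintro x ⟨h1, h2 | h2⟩
      · exact h1 h2
      · exact irrefl_of P.rel _ h2
    · rintro x y z ⟨h1, h2⟩ ⟨h3, h4⟩
      refine ⟨h3, ?_⟩
      rcases h2 with h2 | h2
      · exact Or.inl h2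
      · exact Or.inr (_root_.trans h2 (h4.resolve_left h1))

theorem bestOutside_truncate_moveToTop [Finite S] (P : StrictRanking (Option S)) (s : S) {k : ℕ}
    (hk : 0 < k) : bestOutside ((P.moveToTop (some s)).truncate k) ∅ = some s := by
  refine bestOutside_eq_some.2 ⟨⟨⟨by simp, Or.inl rfl⟩, ?_⟩, by simp, fun t _ _ ht => ?_⟩
  · have : {t : S | (P.moveToTop (some s)).rel (some t) (some s)} = ∅ :=
      Set.eq_empty_of_forall_notMem fun t ht => ht.1 rfl
    simpa [this] using hk
  · exact ⟨by simpa using ht, Or.inl rfl⟩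

theorem isManipulatingStudent_of_isBlockingStudent_boston [Finite I] [Finite S]
    {p : Problem I S} {k : ℕ} (hk : 0 < k) {i : I}
    (h : IsBlockingStudent p (boston.constrained k p) i) :
    IsManipulatingStudent (boston.constrained k) p i := by
  obtain ⟨s, hb⟩ := h
  have := (p.prio s).strictTotal
  refine ⟨(p.pref i).moveToTop (some s), ?_⟩
  have hlt : {j | bestOutside ((p.pref j).truncate k) ∅ = some s ∧
      (p.prio s).rel j i}.ncard < p.cap s := by
    by_contra hle
    refine not_blocks_of_cap_le ?_ hb
    exact (le_ncard_selectBest (p.prio s) (p.cap s)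
      {j | bestOutside ((p.pref j).truncate k) ∅ = some s} i (not_lt.1 hle)).trans
      (Set.ncard_le_ncard (fun j hj => ⟨boston_assign_of_mem_selectBest (p := p.truncate k) hj.1,
        hj.2⟩) (Set.toFinite _))
  have hs : (boston.constrained k (p.misreport i ((p.pref i).moveToTop (some s)))).assign i =
      some s := by
    refine boston_assign_of_mem_selectBest ⟨?_, lt_of_le_of_lt ?_ hlt⟩
    · change bestOutside (((p.misreport i _).pref i).truncate k) ∅ = some s
      rw [misreport_pref_self]
      exact bestOutside_truncate_moveToTop _ _ hk
    · refine Set.ncard_le_ncard ?_ (Set.toFinite _)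
      rintro j ⟨hj, hji⟩
      have hne : j ≠ i := by
        rintro rfl
        exact irrefl_of (p.prio s).rel _ hji
      refine ⟨?_, hji⟩
      change bestOutside (((p.misreport i _).pref j).truncate k) ∅ = some s at hj
      rwa [misreport_pref_of_ne p hne] at hj
  rw [hs]
  exact hb.1

end SchoolChoice

theorem mainTheorem4 {I S : Type*} [Finite I] [Finite S]
    (p : SchoolChoice.Problem I S) (k : ℕ) (hk : 1 < k) :
    (∀ i : I,
      SchoolChoice.IsBlockingStudent p (SchoolChoice.boston.constrained k p) i →
        SchoolChoice.IsManipulatingStudent (SchoolChoice.boston.constrained k) p i) ∧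
    (∀ i : I,
      SchoolChoice.IsManipulatingStudent (SchoolChoice.galeShapley.constrained k) p i →
        SchoolChoice.IsBlockingStudent p (SchoolChoice.galeShapley.constrained k p) i) :=
  ⟨fun _ h => SchoolChoice.isManipulatingStudent_of_isBlockingStudent_boston (by omega) h,
    fun _ h => SchoolChoice.isBlockingStudent_of_isManipulatingStudent_galeShapley h⟩
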